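/- Fix a field $\mathbb{F}$, and let $\mathbf{Vec}^{(\mathbb{R},\le)}$ be the category of functors from the poset $(\mathbb{R},\le)$ to finite-dimensional $\mathbb{F}$-vector spaces. For $\varepsilon\ge 0$, two such diagrams $F,G$ are $\varepsilon$-interleaved if there are natural families of linear maps $\varphi_a:F(a)\to G(a+\varepsilon)$ and $\psi_a:G(a)\to F(a+\varepsilon)$ $(a\in\mathbb{R})$ such that $\psi_{a+\varepsilon}\varphi_a=F(a\le a+2\varepsilon)$ and $\varphi_{a+\varepsilon}\psi_a=G(a\le a+2\varepsilon)$ for all $a$. The interleaving distance is $d(F,G)=\inf\{\varepsilon\ge 0 : F \text{ and } G \text{ are } \varepsilon\text{-interleaved}\}\in[0,\infty]$, with $\inf\emptyset=\infty$. For an interval $I\subseteq\mathbb{R}$ (of any type, possibly empty or unbounded) let $\chi_I$ be the diagram with $\chi_I(a)=\mathbb{F}$ if $a\in I$ and $0$ otherwise, and $\chi_I(a\le b)=\mathrm{Id}_{\mathbb{F}}$ if $a,b\in I$ and $0$ otherwise. A finite barcode is a finite multiset $B=\{I_k\}_{k=1}^n$ of intervals, and $\chi(B)=\bigoplus_{k=1}^n\chi_{I_k}$.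 For finite barcodes $B,B'$ let $$d_B(B,B')=\inf_f\ \sup_I\ d(\chi_I,\chi_{f(I)}),$$ where $f$ ranges over the bijections from the multiset $B$ enlarged by $|B'|$ copies of $\emptyset$ to the multiset $B'$ enlarged by $|B|$ copies of $\emptyset$, and $I$ ranges over the domain of $f$ (the supremum over an empty domain being $0$). Theorem. The bottleneck distance $d_B$ is an extended pseudometric on the set of finite barcodes, the interleaving distance $d$ is an extended pseudometric on the diagrams in $\mathbf{Vec}^{(\mathbb{R},\le)}$, and $\chi$ is an isometric embedding: for all finite barcodes $B,B'$, $$d(\chi(B),\chi(B'))=d_B(B,B'),$$ and if neither $B$ nor $B'$ contains the empty interval and $\chi(B)\cong\chi(B')$, then $B=B'$. -/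

import Mathlib

open CategoryTheory CategoryTheory.Limits
open scoped NNReal ENNReal

namespace Persistence

universe u v w

/-! ## Interleavings of diagrams indexed by the poset of real numbers -/

section Interleavings

variable {D : Type u} [Category.{v} D]

/-- The translation functor `a ↦ a + ε` of the poset category `(ℝ, ≤)`. -/
abbrev shift (ε : ℝ≥0) : ℝ ⥤ ℝ :=
  Monotone.functor (f := fun a : ℝ => a + (ε : ℝ)) (fun _ _ h => by simpa using h)

theorem le_shift_shift (ε : ℝ≥0) (a : ℝ) : a ≤ a + (ε : ℝ) + (ε : ℝ) := by
  have := ε.coe_nonneg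
  linarith

/-- An `ε`-interleaving of two `(ℝ, ≤)`-indexed diagrams `F` and `G`: natural transformations
`φ : F ⟶ G T_ε` and `ψ : G ⟶ F T_ε` whose two composites are the structure maps
`F(a) ⟶ F(a + 2ε)` and `G(a) ⟶ G(a + 2ε)`. -/
structure Interleaving (ε : ℝ≥0) (F G : ℝ ⥤ D) where
  φ : F ⟶ shift ε ⋙ G
  ψ : G ⟶ shift ε ⋙ F
  φ_ψ : ∀ a : ℝ, φ.app a ≫ ψ.app (a + (ε : ℝ)) = F.map (homOfLE (le_shift_shift ε a))
  ψ_φ : ∀ a : ℝ, ψ.app a ≫ φ.app (a + (ε : ℝ)) = G.map (homOfLE (le_shift_shift ε a))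

/-- `F` and `G` are `ε`-interleaved. -/
def Interleaved (ε : ℝ≥0) (F G : ℝ ⥤ D) : Prop :=
  Nonempty (Interleaving ε F G)

/-- The interleaving distance: the infimum of all `ε ≥ 0` such that `F` and `G` are
`ε`-interleaved, and `∞` if there is no such `ε`. -/
noncomputable def interleavingDist (F G : ℝ ⥤ D) : ℝ≥0∞ :=
  ⨅ (ε : ℝ≥0) (_ : Interleaved ε F G), (ε : ℝ≥0∞)

end Interleavings

/-! ## Intervals, barcodes and their diagrams -/

/-- An interval of the real line: an order-connected subset. It may be empty, bounded or unbounded,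
and may or may not contain its endpoints. -/
@[ext]
structure RealInterval where
  carrier : Set ℝ
  ordConnected : carrier.OrdConnected

namespace RealInterval

noncomputable instance : DecidableEq RealInterval := Classical.decEq _

/-- The empty interval. -/
def empty : RealInterval := ⟨∅, Set.ordConnected_empty⟩

end RealInterval

/-- A finite barcode: a finite multiset of intervals. -/
abbrev FiniteBarcode : Type := Multiset RealInterval

section IntervalDiagrams

variable (K : Type u) [Field K]

/-- The category of `(ℝ, ≤)`-indexed diagrams of finite-dimensional `K`-vector spaces. -/
abbrev VecDiagram : Type (u + 1) := ℝ ⥤ FGModuleCat.{u} K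

instance : HasFiniteBiproducts (VecDiagram K) :=
  HasFiniteBiproducts.of_hasFiniteProducts

/-- The value at `a` of the interval diagram of `I`: the ground field `K` if `a ∈ I`, and `0`
otherwise, as a subspace of `K`. -/
def intervalFiber (I : RealInterval) (a : ℝ) : Submodule K K where
  carrier := {x | a ∉ I.carrier → x = 0}
  zero_mem' := fun _ => rfl
  add_mem' := fun hx hy h => by rw [hx h, hy h, add_zero]
  smul_mem' := fun c x hx h => by rw [hx h, smul_zero]

theorem intervalFiber_of_mem {I : RealInterval} {a : ℝ} (h : a ∈ I.carrier) :
    intervalFiber K I a = ⊤ := by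
  ext x
  simp [intervalFiber, h]

theorem intervalFiber_of_notMem {I : RealInterval} {a : ℝ} (h : a ∉ I.carrier) :
    intervalFiber K I a = ⊥ := by
  ext x
  simp [intervalFiber, h]

open Classical in
/-- The structure maps of the interval diagram of `I`: the identity of `K` if `a, b ∈ I`, and `0`
otherwise. -/
noncomputable def intervalMap (I : RealInterval) (a b : ℝ) :
    intervalFiber K I a →ₗ[K] intervalFiber K I b where
  toFun x := ⟨if a ∈ I.carrier ∧ b ∈ I.carrier then (x : K) else 0, fun hb => if_neg fun h => hb h.2⟩
  map_add' x y := by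
    ext
    by_cases h : a ∈ I.carrier ∧ b ∈ I.carrier <;> simp [h]
  map_smul' c x := by
    ext
    by_cases h : a ∈ I.carrier ∧ b ∈ I.carrier <;> simp [h]

theorem intervalMap_self (I : RealInterval) (a : ℝ) : intervalMap K I a a = LinearMap.id := by
  ext x
  by_cases h : a ∈ I.carrier
  · simp [intervalMap, h]
  · have hx : (x : K) = 0 := x.2 h
    simp [intervalMap, h, hx]

theorem intervalMap_comp (I : RealInterval) {a b c : ℝ} (hab : a ≤ b) (hbc : b ≤ c) :
    (intervalMap K I b c).comp (intervalMap K I a b) = intervalMap K I a c := by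
  ext x
  by_cases ha : a ∈ I.carrier
  · by_cases hc : c ∈ I.carrier
    · have hb : b ∈ I.carrier := I.ordConnected.out ha hc ⟨hab, hbc⟩
      simp [intervalMap, ha, hb, hc]
    · simp [intervalMap, hc]
  · simp [intervalMap, ha]

/-- The interval diagram `χ_I`, an `(ℝ, ≤)`-indexed diagram of finite-dimensional `K`-vector
spaces. -/
noncomputable def intervalDiagram (I : RealInterval) : VecDiagram K where
  obj a := FGModuleCat.of K (intervalFiber K I a)
  map {a b} _ := FGModuleCat.ofHom (intervalMap K I a b)
  map_id a := by
    rw [intervalMap_self]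
    rfl
  map_comp {a b c} f g := by
    rw [← intervalMap_comp K I (leOfHom f) (leOfHom g)]
    rfl

/-- The diagram `χ(B)` of a finite barcode `B`: the direct sum, in the category of
`(ℝ, ≤)`-indexed diagrams, of the interval diagrams of the members of `B`, counted with
multiplicity. -/
noncomputable def barcodeDiagram (B : FiniteBarcode) : VecDiagram K :=
  ⨁ fun I : B.ToType => intervalDiagram K I.1

/-- A stable bijection (partial matching) between finite barcodes `B` and `B'`: a bijection between
the multiset `B` enlarged by `|B'|` copies of the empty interval and the multiset `B'` enlarged by
`|B|` copies of the empty interval. -/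
abbrev StableBijection (B B' : FiniteBarcode) : Type :=
  (B + Multiset.replicate (Multiset.card B') RealInterval.empty).ToType ≃
    (B' + Multiset.replicate (Multiset.card B) RealInterval.empty).ToType

/-- The bottleneck distance of finite barcodes. -/
noncomputable def bottleneckDist (B B' : FiniteBarcode) : ℝ≥0∞ :=
  ⨅ f : StableBijection B B',
    ⨆ I, interleavingDist (intervalDiagram K I.1) (intervalDiagram K (f I).1)

end IntervalDiagrams

/-- An extended pseudometric: it may take the value `∞`, and distinct points may have
distance `0`. -/
structure IsExtendedPseudometric {X : Type w} (d : X → X → ℝ≥0∞) : Prop where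
  self : ∀ x, d x x = 0
  symm : ∀ x y, d x y = d y x
  triangle : ∀ x y z, d x z ≤ d x y + d y z

end Persistence

/-! The inequality `d ≤ d_B` is formal: interleavings of matched summands add up to an interleaving
of direct sums, and empty intervals contribute zero summands. For `d_B ≤ d`, a degree-`ε` morphism
between interval diagrams is a single scalar, nonzero only if both ends of the target lie at most
`ε` above those of the source (`DegreeHom.exists_scalar`). An `ε`-interleaving of direct sums thus
becomes two scalar matrices `C`, `D` (`Interleaved.exists_matrix`). Restricted to intervals longer
than `2ε` and ordered by midpoint, the product `C * D` agrees with the identity on one side of the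
diagonal, and every nonzero product `C i j * D j i'` on that side makes the `j`-th interval close to
the `i`-th or the `i'`-th. Linear independence then gives Hall's condition
(`exists_injective_of_matrix`), so the long intervals of each barcode inject into the other barcode
with close partners. The short intervals are close to the empty one, and a relational
Schröder–Bernstein theorem merges the two injections into one bijection (`exists_rel_of_injOn`).
Uniqueness uses the same matrix lemma at `ε = 0`, with intervals preordered by domination, which
also detects whether endpoints belong to them. The pseudometric axioms for `d_B` are inherited from
`d` through the isometry. -/

namespace Persistence

universe u v

/-! ### Interleavings as morphisms of a given degree; the interleaving distance. -/

section InterleavingDistance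

variable {D : Type u} [Category.{v} D]

/-- A morphism of degree `ε` of `(ℝ, ≤)`-indexed diagrams: a compatible family of morphisms
`F(a) ⟶ G(b)` for `a + ε ≤ b`. -/
structure DegreeHom (ε : ℝ≥0) (F G : ℝ ⥤ D) where
  app : ∀ {a b : ℝ}, a + (ε : ℝ) ≤ b → (F.obj a ⟶ G.obj b)
  map_app : ∀ {a b c : ℝ} (h : a ≤ b) (h' : b + (ε : ℝ) ≤ c),
    F.map (homOfLE h) ≫ app h' = app ((add_le_add_left h _).trans h')
  app_map : ∀ {a b c : ℝ} (h : a + (ε : ℝ) ≤ b) (h' : b ≤ c),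
    app h ≫ G.map (homOfLE h') = app (h.trans h')

/-- The morphism of degree `ε` given by a natural transformation into a shifted diagram. -/
def DegreeHom.ofNatTrans {F G : ℝ ⥤ D} {ε : ℝ≥0} (η : F ⟶ shift ε ⋙ G) : DegreeHom ε F G where
  app {a _} h := η.app a ≫ G.map (homOfLE h)
  map_app h h' := by
    rw [← Category.assoc, η.naturality, Category.assoc]
    exact congrArg _ (G.map_comp _ _).symm
  app_map h h' := by
    rw [Category.assoc]
    exact congrArg _ (G.map_comp _ _).symm

/-- The natural transformation into a shifted diagram given by a morphism of degree `ε`. -/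
def DegreeHom.toNatTrans {F G : ℝ ⥤ D} {ε : ℝ≥0} (φ : DegreeHom ε F G) : F ⟶ shift ε ⋙ G where
  app _ := φ.app le_rfl
  naturality _ _ f := (φ.map_app (leOfHom f) le_rfl).trans
    (φ.app_map le_rfl (add_le_add_left (leOfHom f) (ε : ℝ))).symm

theorem le_of_add_le {ε δ : ℝ≥0} {a b c : ℝ} (h : a + (ε : ℝ) ≤ b) (h' : b + (δ : ℝ) ≤ c) :
    a ≤ c := by
  linarith [ε.coe_nonneg, δ.coe_nonneg]

/-- Letting source and target range over all pairs with `a + ε ≤ b` replaces equalities between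
iterated shifts by inequalities of reals, so that changing or adding degrees needs no transport of
objects. -/
theorem interleaved_iff {F G : ℝ ⥤ D} {ε : ℝ≥0} :
    Interleaved ε F G ↔ ∃ (φ : DegreeHom ε F G) (ψ : DegreeHom ε G F),
      (∀ {a b c : ℝ} (h : a + (ε : ℝ) ≤ b) (h' : b + (ε : ℝ) ≤ c),
        φ.app h ≫ ψ.app h' = F.map (homOfLE (le_of_add_le h h'))) ∧
      (∀ {a b c : ℝ} (h : a + (ε : ℝ) ≤ b) (h' : b + (ε : ℝ) ≤ c),
        ψ.app h ≫ φ.app h' = G.map (homOfLE (le_of_add_le h h'))) := by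
  constructor
  · have key : ∀ {F G : ℝ ⥤ D} (φ : F ⟶ shift ε ⋙ G) (ψ : G ⟶ shift ε ⋙ F)
        (H : ∀ a : ℝ, φ.app a ≫ ψ.app (a + (ε : ℝ)) = F.map (homOfLE (le_shift_shift ε a)))
        {a b c : ℝ} (h : a + (ε : ℝ) ≤ b) (h' : b + (ε : ℝ) ≤ c),
        (DegreeHom.ofNatTrans φ).app h ≫ (DegreeHom.ofNatTrans ψ).app h' =
          F.map (homOfLE (le_of_add_le h h')) := by
      intro F G φ ψ H a b c h h'
      have h₁ : (DegreeHom.ofNatTrans φ).app h = φ.app a ≫ G.map (homOfLE h) := rfl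
      have h₂ : φ.app a ≫ (DegreeHom.ofNatTrans ψ).app ((add_le_add_left h (ε : ℝ)).trans h') =
          (φ.app a ≫ ψ.app (a + (ε : ℝ))) ≫ F.map (homOfLE _) :=
        (Category.assoc _ _ _).symm
      rw [h₁, Category.assoc]
      refine (congrArg _ ((DegreeHom.ofNatTrans ψ).map_app h h')).trans ?_
      refine h₂.trans ((congrArg (· ≫ F.map _) (H a)).trans ?_)
      exact (F.map_comp _ _).symm
    rintro ⟨⟨φ, ψ, h₁, h₂⟩⟩
    exact ⟨.ofNatTrans φ, .ofNatTrans ψ, key φ ψ h₁, key ψ φ h₂⟩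
  · rintro ⟨φ, ψ, h₁, h₂⟩
    exact ⟨⟨φ.toNatTrans, ψ.toNatTrans, fun a => h₁ le_rfl le_rfl, fun a => h₂ le_rfl le_rfl⟩⟩

/-- A morphism of degree `ε` is also one of every larger degree. -/
def DegreeHom.extend {F G : ℝ ⥤ D} {ε δ : ℝ≥0} (hεδ : ε ≤ δ) (φ : DegreeHom ε F G) :
    DegreeHom δ F G where
  app {a _} h := φ.app ((add_le_add_right (NNReal.coe_le_coe.2 hεδ) a).trans h)
  map_app _ _ := φ.map_app _ _
  app_map _ _ := φ.app_map _ _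

theorem Interleaved.mono {F G : ℝ ⥤ D} {ε δ : ℝ≥0} (hεδ : ε ≤ δ) (H : Interleaved ε F G) :
    Interleaved δ F G := by
  obtain ⟨φ, ψ, h₁, h₂⟩ := interleaved_iff.1 H
  exact interleaved_iff.2 ⟨φ.extend hεδ, ψ.extend hεδ, fun _ _ => h₁ _ _, fun _ _ => h₂ _ _⟩

theorem Interleaved.symm {F G : ℝ ⥤ D} {ε : ℝ≥0} (H : Interleaved ε F G) : Interleaved ε G F :=
  H.map fun i => ⟨i.ψ, i.φ, i.ψ_φ, i.φ_ψ⟩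

/-- The composite of morphisms of degrees `ε` and `δ`. -/
def DegreeHom.comp {F G H : ℝ ⥤ D} {ε δ κ : ℝ≥0} (φ : DegreeHom ε F G) (θ : DegreeHom δ G H)
    (hκ : ε + δ = κ) : DegreeHom κ F H where
  app {a b} h := φ.app (le_refl (a + (ε : ℝ))) ≫
    θ.app (by rw [← hκ] at h; push_cast at h; linarith)
  map_app {a b c} h h' := by
    rw [← Category.assoc, φ.map_app, ← φ.app_map le_rfl (add_le_add_left h (ε : ℝ)),
      Category.assoc, θ.map_app]
  app_map {a b c} h h' := by rw [Category.assoc, θ.app_map]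

theorem DegreeHom.comp_comp_eq_map {F G H : ℝ ⥤ D} {ε δ κ : ℝ≥0} (φ : DegreeHom ε F G)
    (ψ : DegreeHom ε G F) (θ : DegreeHom δ G H) (ξ : DegreeHom δ H G)
    (h₁ : ∀ {a b c : ℝ} (h : a + (ε : ℝ) ≤ b) (h' : b + (ε : ℝ) ≤ c),
      φ.app h ≫ ψ.app h' = F.map (homOfLE (le_of_add_le h h')))
    (h₂ : ∀ {a b c : ℝ} (h : a + (δ : ℝ) ≤ b) (h' : b + (δ : ℝ) ≤ c),
      θ.app h ≫ ξ.app h' = G.map (homOfLE (le_of_add_le h h')))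
    (hκ : ε + δ = κ) (hκ' : δ + ε = κ)
    {a b c : ℝ} (h : a + (κ : ℝ) ≤ b) (h' : b + (κ : ℝ) ≤ c) :
    (φ.comp θ hκ).app h ≫ (ξ.comp ψ hκ').app h' = F.map (homOfLE (le_of_add_le h h')) := by
  simp only [comp, Category.assoc]
  rw [← Category.assoc (θ.app _), h₂, ψ.map_app, h₁]

theorem Interleaved.trans {F G H : ℝ ⥤ D} {ε δ : ℝ≥0} (h : Interleaved ε F G)
    (h' : Interleaved δ G H) : Interleaved (ε + δ) F H := by
  obtain ⟨φ, ψ, h₁, h₂⟩ := interleaved_iff.1 h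
  obtain ⟨θ, ξ, h₃, h₄⟩ := interleaved_iff.1 h'
  exact interleaved_iff.2 ⟨φ.comp θ rfl, ξ.comp ψ (add_comm _ _),
    DegreeHom.comp_comp_eq_map φ ψ θ ξ h₁ h₃ _ _, DegreeHom.comp_comp_eq_map ξ θ ψ φ h₄ h₂ _ _⟩

/-- The morphism of degree `0` given by a natural transformation. -/
def DegreeHom.ofHom {F G : ℝ ⥤ D} (η : F ⟶ G) : DegreeHom 0 F G where
  app {a b} h := F.map (homOfLE (by simpa using h)) ≫ η.app b
  map_app h h' := by rw [← Category.assoc, ← F.map_comp, homOfLE_comp]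
  app_map h h' := by
    rw [Category.assoc, ← η.naturality, ← Category.assoc, ← F.map_comp, homOfLE_comp]

theorem Interleaved.of_iso {F G : ℝ ⥤ D} (e : F ≅ G) : Interleaved 0 F G := by
  refine interleaved_iff.2 ⟨.ofHom e.hom, .ofHom e.inv, fun h h' => ?_, fun h h' => ?_⟩
  · simp only [DegreeHom.ofHom, Category.assoc]
    rw [← e.hom.naturality_assoc, e.hom_inv_id_app, Category.comp_id, ← F.map_comp, homOfLE_comp]
  · simp only [DegreeHom.ofHom, Category.assoc]
    rw [← e.inv.naturality_assoc, e.inv_hom_id_app, Category.comp_id, ← G.map_comp, homOfLE_comp]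

theorem interleavingDist_le {F G : ℝ ⥤ D} {ε : ℝ≥0} (h : Interleaved ε F G) :
    interleavingDist F G ≤ ε :=
  iInf₂_le ε h

theorem Interleaved.of_interleavingDist_lt {F G : ℝ ⥤ D} {ε : ℝ≥0}
    (h : interleavingDist F G < ε) : Interleaved ε F G := by
  simp only [interleavingDist, iInf_lt_iff] at h
  obtain ⟨δ, hδ, hlt⟩ := h
  exact hδ.mono (by exact_mod_cast hlt.le)

/-- The infimum need not be attained: an open and a closed interval with the same ends are at
distance `0` without being `0`-interleaved. -/
theorem interleavingDist_le_of_forall_lt {F G : ℝ ⥤ D} {ε : ℝ≥0}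
    (h : ∀ δ : ℝ≥0, ε < δ → Interleaved δ F G) : interleavingDist F G ≤ ε := by
  refine le_of_forall_gt_imp_ge_of_dense fun c hc => ?_
  obtain ⟨δ, h₁, h₂⟩ := ENNReal.lt_iff_exists_nnreal_btwn.1 hc
  exact (interleavingDist_le (h δ (by exact_mod_cast h₁))).trans h₂.le

theorem interleavingDist_eq_zero_of_iso {F G : ℝ ⥤ D} (e : F ≅ G) :
    interleavingDist F G = 0 :=
  le_antisymm (by simpa using interleavingDist_le (Interleaved.of_iso e)) bot_le

theorem isExtendedPseudometric_interleavingDist :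
    IsExtendedPseudometric (fun F G : ℝ ⥤ D => interleavingDist F G) where
  self F := interleavingDist_eq_zero_of_iso (Iso.refl F)
  symm F G := by
    have : ∀ F G : ℝ ⥤ D, interleavingDist F G ≤ interleavingDist G F := fun F G =>
      le_iInf₂ fun _ h => interleavingDist_le h.symm
    exact le_antisymm (this F G) (this G F)
  triangle F G H := by
    simp only [interleavingDist, ENNReal.iInf_add, ENNReal.add_iInf]
    refine le_iInf₂ fun ε hε => le_iInf₂ fun δ hδ => ?_
    exact_mod_cast interleavingDist_le (hδ.trans hε)

theorem interleavingDist_eq_of_iso {F G F' G' : ℝ ⥤ D} (e : F ≅ F') (e' : G ≅ G') :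
    interleavingDist F G = interleavingDist F' G' := by
  have hd := isExtendedPseudometric_interleavingDist (D := D)
  have key : ∀ {F G F' G' : ℝ ⥤ D} (_ : F ≅ F') (_ : G ≅ G'),
      interleavingDist F G ≤ interleavingDist F' G' := by
    intro F G F' G' e e'
    refine (hd.triangle F F' G).trans ((add_le_add_right (hd.triangle F' G' G) _).trans ?_)
    simp [interleavingDist_eq_zero_of_iso e, interleavingDist_eq_zero_of_iso e'.symm]
  exact le_antisymm (key e e') (key e.symm e'.symm)

end InterleavingDistance

/-! ### Direct sums of diagrams and matrices of morphisms. -/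

section Biproducts

variable {D : Type u} [Category.{v} D] [Preadditive D]

/-- A biproduct is unchanged when zero summands are omitted. -/
noncomputable def biproductIsoOfInjective {ι κ : Type} [Fintype ι] [Fintype κ]
    [HasFiniteBiproducts D] (F : ι → D) {j : κ → ι} (hj : Function.Injective j)
    (hF : ∀ i, i ∉ Set.range j → IsZero (F i)) : (⨁ fun k => F (j k)) ≅ ⨁ F where
  hom := biproduct.desc fun k => biproduct.ι F (j k)
  inv := biproduct.lift fun k => biproduct.π F (j k)
  hom_inv_id := by
    classical
    ext k l
    rcases eq_or_ne k l with rfl | h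
    · simp
    · rw [Category.id_comp, Category.assoc, biproduct.ι_desc_assoc, biproduct.lift_π,
        biproduct.ι_π_ne _ h.symm,
        biproduct.ι_π_ne _ (hj.ne h.symm)]
  inv_hom_id := by
    classical
    rw [biproduct.lift_desc, ← biproduct.total]
    refine Finset.sum_of_injOn j hj.injOn (by simp) (fun i _ hi => ?_) (fun _ _ => rfl)
    rw [(hF i (by simpa using hi)).eq_of_tgt (biproduct.π F i) 0, zero_comp]

variable [HasFiniteBiproducts (ℝ ⥤ D)]

theorem total_app {ι : Type} [Fintype ι] (F : ι → ℝ ⥤ D) (a : ℝ) :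
    ∑ i, (biproduct.π F i).app a ≫ (biproduct.ι F i).app a = 𝟙 ((⨁ F).obj a) := by
  have := congrArg (fun η : ⨁ F ⟶ ⨁ F => η.app a) (biproduct.total (f := F))
  rwa [NatTrans.app_sum] at this

theorem ι_π_app_self {ι : Type} [Fintype ι] (F : ι → ℝ ⥤ D) (i : ι) (a : ℝ) :
    (biproduct.ι F i).app a ≫ (biproduct.π F i).app a = 𝟙 ((F i).obj a) := by
  rw [← NatTrans.comp_app, biproduct.ι_π_self, NatTrans.id_app]

theorem ι_π_app_ne {ι : Type} [Fintype ι] (F : ι → ℝ ⥤ D) {i j : ι} (h : i ≠ j) (a : ℝ) :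
    (biproduct.ι F i).app a ≫ (biproduct.π F j).app a = 0 := by
  rw [← NatTrans.comp_app, biproduct.ι_π_ne _ h, NatTrans.app_zero]

/-- The morphism of degree `ε` between direct sums with entries `φ t` at `(p t, q t)`. -/
noncomputable def DegreeHom.biproductMap {ι κ τ : Type} [Fintype ι] [Fintype κ] [Fintype τ]
    {ε : ℝ≥0} (F : ι → ℝ ⥤ D) (G : κ → ℝ ⥤ D) (p : τ → ι) (q : τ → κ)
    (φ : ∀ t, DegreeHom ε (F (p t)) (G (q t))) : DegreeHom ε (⨁ F) (⨁ G) where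
  app {a b} h := ∑ t, (biproduct.π F (p t)).app a ≫ (φ t).app h ≫ (biproduct.ι G (q t)).app b
  map_app h h' := by
    rw [Preadditive.comp_sum]
    refine Finset.sum_congr rfl fun t _ => ?_
    rw [NatTrans.naturality_assoc, ← (φ t).map_app h h', Category.assoc]
  app_map h h' := by
    rw [Preadditive.sum_comp]
    refine Finset.sum_congr rfl fun t _ => ?_
    rw [Category.assoc, Category.assoc, ← NatTrans.naturality, ← (φ t).app_map h h', Category.assoc]

/-- Injectivity of `q` kills the cross terms, and bijectivity of `p` makes the diagonal terms sum to
the identity. Indexing by a third type `τ` treats a matching and its inverse alike, without casts.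
-/
theorem DegreeHom.biproductMap_comp {ι κ τ : Type} [Fintype ι] [Fintype κ] [Fintype τ]
    {ε : ℝ≥0} {F : ι → ℝ ⥤ D} {G : κ → ℝ ⥤ D} (p : τ ≃ ι) {q : τ → κ}
    (hq : Function.Injective q)
    {φ : ∀ t, DegreeHom ε (F (p t)) (G (q t))} {ψ : ∀ t, DegreeHom ε (G (q t)) (F (p t))}
    (H : ∀ t {a b c : ℝ} (h : a + (ε : ℝ) ≤ b) (h' : b + (ε : ℝ) ≤ c),
      (φ t).app h ≫ (ψ t).app h' = (F (p t)).map (homOfLE (le_of_add_le h h')))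
    {a b c : ℝ} (h : a + (ε : ℝ) ≤ b) (h' : b + (ε : ℝ) ≤ c) :
    (biproductMap F G p q φ).app h ≫ (biproductMap G F q p ψ).app h' =
      (⨁ F).map (homOfLE (le_of_add_le h h')) := by
  simp only [biproductMap, Preadditive.sum_comp, Preadditive.comp_sum, Category.assoc]
  have : ∀ t, ∑ s, (biproduct.π F (p s)).app a ≫ (φ s).app h ≫ (biproduct.ι G (q s)).app b ≫
      (biproduct.π G (q t)).app b ≫ (ψ t).app h' ≫ (biproduct.ι F (p t)).app c =
      ((biproduct.π F (p t)).app a ≫ (biproduct.ι F (p t)).app a) ≫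
        (⨁ F).map (homOfLE (le_of_add_le h h')) := by
    intro t
    rw [Finset.sum_eq_single t]
    · rw [← Category.assoc ((biproduct.ι G (q t)).app b), ι_π_app_self, Category.id_comp,
        ← Category.assoc ((φ t).app h), H, Category.assoc, NatTrans.naturality]
    · intro s _ hs
      rw [← Category.assoc ((biproduct.ι G (q s)).app b), ι_π_app_ne _ (hq.ne hs)]
      simp
    · simp
  rw [Finset.sum_congr rfl fun t _ => this t]
  rw [← Preadditive.sum_comp, p.sum_comp fun i => (biproduct.π F i).app a ≫ (biproduct.ι F i).app a,
    total_app, Category.id_comp]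

/-- The component of a morphism of degree `ε` between direct sums. -/
noncomputable def DegreeHom.component {ι κ : Type} [Fintype ι] [Fintype κ] {ε : ℝ≥0}
    {F : ι → ℝ ⥤ D} {G : κ → ℝ ⥤ D} (φ : DegreeHom ε (⨁ F) (⨁ G)) (i : ι) (j : κ) :
    DegreeHom ε (F i) (G j) where
  app {a b} h := (biproduct.ι F i).app a ≫ φ.app h ≫ (biproduct.π G j).app b
  map_app h h' := by
    rw [NatTrans.naturality_assoc, ← φ.map_app h h', Category.assoc]
  app_map h h' := by
    rw [← φ.app_map h h', Category.assoc, Category.assoc, Category.assoc, NatTrans.naturality]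

/-- Matrix multiplication: the middle identity is expanded as the sum of its projections. The
right-hand side is the structure map of `F i` if `i = i'`, and zero otherwise. -/
theorem DegreeHom.sum_component_comp {ι κ : Type} [Fintype ι] [Fintype κ] [DecidableEq ι] {ε : ℝ≥0}
    {F : ι → ℝ ⥤ D} {G : κ → ℝ ⥤ D} (φ : DegreeHom ε (⨁ F) (⨁ G)) (ψ : DegreeHom ε (⨁ G) (⨁ F))
    (H : ∀ {a b c : ℝ} (h : a + (ε : ℝ) ≤ b) (h' : b + (ε : ℝ) ≤ c),
      φ.app h ≫ ψ.app h' = (⨁ F).map (homOfLE (le_of_add_le h h')))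
    (i i' : ι) {a b c : ℝ} (h : a + (ε : ℝ) ≤ b) (h' : b + (ε : ℝ) ≤ c) :
    ∑ j, (φ.component i j).app h ≫ (ψ.component j i').app h' =
      (F i).map (homOfLE (le_of_add_le h h')) ≫
        (biproduct.ι F i).app c ≫ (biproduct.π F i').app c := by
  simp only [component, Category.assoc, ← Preadditive.comp_sum]
  have : ∑ j, (biproduct.π G j).app b ≫ (biproduct.ι G j).app b ≫ ψ.app h' ≫
      (biproduct.π F i').app c = ψ.app h' ≫ (biproduct.π F i').app c := by
    simp only [← Category.assoc, ← Preadditive.sum_comp]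
    rw [total_app, Category.id_comp]
  rw [this, ← Category.assoc (φ.app h), H, NatTrans.naturality_assoc]

theorem Interleaved.biproduct {ι κ : Type} [Fintype ι] [Fintype κ] {ε : ℝ≥0}
    {F : ι → ℝ ⥤ D} {G : κ → ℝ ⥤ D} (e : ι ≃ κ) (H : ∀ i, Interleaved ε (F i) (G (e i))) :
    Interleaved ε (⨁ F) (⨁ G) := by
  classical
  simp only [interleaved_iff] at H
  choose φ ψ h₁ h₂ using H
  exact interleaved_iff.2 ⟨.biproductMap F G (Equiv.refl ι) e φ,
    .biproductMap G F e (Equiv.refl ι) ψ,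
    DegreeHom.biproductMap_comp (Equiv.refl ι) e.injective h₁,
    DegreeHom.biproductMap_comp e (Equiv.refl ι).injective h₂⟩

theorem interleavingDist_biproduct_le {ι κ : Type} [Fintype ι] [Fintype κ]
    {F : ι → ℝ ⥤ D} {G : κ → ℝ ⥤ D} (e : ι ≃ κ) :
    interleavingDist (⨁ F) (⨁ G) ≤ ⨆ i, interleavingDist (F i) (G (e i)) := by
  refine le_of_forall_gt_imp_ge_of_dense fun c hc => ?_
  obtain ⟨δ, h₁, h₂⟩ := ENNReal.lt_iff_exists_nnreal_btwn.1 hc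
  refine (interleavingDist_le (Interleaved.biproduct e fun i => ?_)).trans h₂.le
  exact Interleaved.of_interleavingDist_lt
    ((le_iSup (fun i => interleavingDist (F i) (G (e i))) i).trans_lt h₁)

end Biproducts

/-! ### Combinatorics: Hall's theorem and Schröder–Bernstein for barcodes. -/

section Matching

/-- If `C * D` is unitriangular up to reordering, and all of its relevant contributions come from
related pairs, then the row indices inject into the column indices along the relation. -/
theorem exists_injective_of_matrix {K ι κ : Type*} [Field K] [Fintype ι] [Fintype κ]
    [DecidableEq ι] [Preorder ι] (C : ι → κ → K) (D : κ → ι → K) (rel : ι → κ → Prop)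
    (hsum : ∀ i i', ¬ i' < i → ∑ j, C i j * D j i' = if i = i' then 1 else 0)
    (hrel : ∀ i i' j, ¬ i' < i → C i j ≠ 0 → D j i' ≠ 0 → rel i j ∨ rel i' j) :
    ∃ f : ι → κ, Function.Injective f ∧ ∀ i, rel i (f i) := by
  classical
  -- By Hall's marriage theorem it is enough that every set of rows has at least as many related
  -- columns.
  suffices h : ∀ A : Finset ι, A.card ≤ (A.biUnion fun i => Finset.univ.filter (rel i)).card by
    obtain ⟨f, hf, hr⟩ := (Finset.all_card_le_biUnion_card_iff_exists_injective _).1 h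
    exact ⟨f, hf, fun i => by simpa using hr i⟩
  intro A
  by_contra! hlt
  set N := A.biUnion fun i => Finset.univ.filter (rel i) with hN
  -- With fewer columns in `N` than rows in `A`, the rows restricted to `N` are linearly dependent.
  obtain ⟨v, hv, i₀, hi₀⟩ : ∃ v : A → K, (∑ i : A, v i • fun j : N => C i j) = 0 ∧
      ∃ i, v i ≠ 0 := by
    refine Fintype.not_linearIndependent_iff.1 fun hli => ?_
    have := hli.fintype_card_le_finrank
    simp only [Module.finrank_fintype_fun_eq_card, Fintype.card_coe] at this
    omega
  -- Maximality of `m` in the support puts each pair `(i, m)` on the side of the diagonal where the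
  -- hypotheses apply. Pairing the dependence with column `m` of `D` then isolates `v m`.
  obtain ⟨m, hm⟩ := (Finset.univ.filter fun i : A => v i ≠ 0).exists_maximal ⟨i₀, by simpa⟩
  have hvm : v m ≠ 0 := by simpa using hm.1
  have hnlt : ∀ i : A, v i ≠ 0 → ¬ (m : ι) < i := fun i hi hlt =>
    hm.not_gt (by simpa using hi) hlt
  have hC : ∀ j ∈ N, ∑ i : A, v i * C i j = 0 := fun j hj => by
    simpa using congrFun hv ⟨j, hj⟩
  have hM : ∀ i : A, v i ≠ 0 → ∑ j ∈ N, C i j * D j m = if i = m then 1 else 0 := by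
    intro i hi
    have h := hsum i m (hnlt i hi)
    rw [← Finset.sum_subset N.subset_univ] at h
    · simpa only [Subtype.coe_inj] using h
    -- A nonzero term would make `j` related to `i` or `m`, both in `A`, hence an element of `N`.
    · intro j _ hj
      by_contra hne
      have := hrel i m j (hnlt i hi) (left_ne_zero_of_mul hne) (right_ne_zero_of_mul hne)
      refine hj (Finset.mem_biUnion.2 ?_)
      rcases this with h | h
      · exact ⟨i, i.2, by simpa using h⟩
      · exact ⟨m, m.2, by simpa using h⟩
  refine hvm ?_
  calc v m = ∑ i : A, v i * ∑ j ∈ N, C i j * D j m := by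
        rw [Finset.sum_eq_single m]
        · rw [hM m hvm, if_pos rfl, mul_one]
        · intro i _ him
          by_cases hi : v i = 0
          · rw [hi, zero_mul]
          · rw [hM i hi, if_neg him, mul_zero]
        · simp
    _ = ∑ j ∈ N, (∑ i : A, v i * C i j) * D j m := by
        simp only [Finset.mul_sum, Finset.sum_mul, mul_assoc]
        exact Finset.sum_comm
    _ = 0 := Finset.sum_eq_zero fun j hj => by rw [hC j hj, zero_mul]

/-- Prolonging a partial injection by new elements. -/
theorem exists_injective_sum_nat {α ι κ : Type*} [Fintype ι] (R : α → α → Prop) (z : α)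
    (hz : R z z) (b : ι → α) (b' : κ → α) (s : Set ι) (hs : ∀ i ∉ s, R (b i) z)
    (f : s → κ) (hf : Function.Injective f) (hfR : ∀ i : s, R (b i) (b' (f i))) :
    ∃ F : ι ⊕ ℕ → κ ⊕ ℕ, Function.Injective F ∧
      ∀ x, R (Sum.elim b (fun _ => z) x) (Sum.elim b' (fun _ => z) (F x)) := by
  classical
  -- Indices outside `s` use copies of `z` numbered below `card ι`; the original copies of `z` are
  -- shifted by `card ι` to make room.
  refine ⟨Sum.elim (fun i => if h : i ∈ s then Sum.inl (f ⟨i, h⟩)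
    else Sum.inr (Fintype.equivFin ι i : ℕ)) fun n => Sum.inr (n + Fintype.card ι), ?_, ?_⟩
  · have hlt : ∀ i : ι, (Fintype.equivFin ι i : ℕ) < Fintype.card ι := fun i => Fin.is_lt _
    rintro (i | m) (j | n) h
    · simp only [Sum.elim_inl] at h
      split_ifs at h
      · simpa using hf (Sum.inl_injective h)
      · simpa [Fin.val_inj] using h
    · simp only [Sum.elim_inl, Sum.elim_inr] at h
      split_ifs at h
      have := hlt i
      simp only [Sum.inr.injEq] at h
      omega
    · simp only [Sum.elim_inl, Sum.elim_inr] at h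
      split_ifs at h
      have := hlt j
      simp only [Sum.inr.injEq] at h
      omega
    · simpa using h
  · rintro (i | n)
    · by_cases h : i ∈ s
      · simpa [h] using hfR ⟨i, h⟩
      · simpa [h] using hs i h
    · simpa using hz

theorem map_elim_val {α ι : Type*} [Fintype ι] (b : ι → α) (z : α)
    (X : Finset (ι ⊕ ℕ)) (hX : ∀ i, Sum.inl i ∈ X) :
    X.val.map (Sum.elim b fun _ => z) =
      Finset.univ.val.map b + Multiset.replicate (X.card - Fintype.card ι) z := by
  have hl : X.toLeft = Finset.univ := by ext i; simp [hX]
  have hc := X.card_toLeft_add_card_toRight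
  rw [hl, Finset.card_univ] at hc
  conv_lhs => rw [← X.toLeft_disjSum_toRight]
  rw [hl, Finset.val_disjSum, Multiset.disjSum, Multiset.map_add, Multiset.map_map,
    Multiset.map_map]
  congr 1
  simp [Function.comp_def, ← hc]

/-- A relation between the terms of two finite families that are matched both ways gives a
bijection of the multisets of terms, after padding by a term `z`. -/
theorem exists_rel_of_injOn {α ι κ : Type*} [Fintype ι] [Fintype κ] (R : α → α → Prop) (z : α)
    (hz : R z z) (b : ι → α) (b' : κ → α) (s : Set ι) (t : Set κ)
    (hs : ∀ i ∉ s, R (b i) z) (ht : ∀ j ∉ t, R z (b' j))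
    (f : s → κ) (hf : Function.Injective f) (hfR : ∀ i : s, R (b i) (b' (f i)))
    (g : t → ι) (hg : Function.Injective g) (hgR : ∀ j : t, R (b (g j)) (b' j)) :
    Multiset.Rel R
      (Finset.univ.val.map b + Multiset.replicate (Fintype.card κ) z)
      (Finset.univ.val.map b' + Multiset.replicate (Fintype.card ι) z) := by
  classical
  obtain ⟨F, hF, hFR⟩ := exists_injective_sum_nat R z hz b b' s hs f hf hfR
  obtain ⟨G, hG, hGR⟩ := exists_injective_sum_nat (flip R) z hz b' b t ht g hg hgR
  -- With infinitely many copies of `z` on both sides, both partial matchings are total injections,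
  -- and the resulting bijection only uses related pairs.
  obtain ⟨h, hh, hR⟩ := Function.Embedding.schroeder_bernstein_of_rel hF hG
    (fun x y => R (Sum.elim b (fun _ => z) x) (Sum.elim b' (fun _ => z) y)) hFR hGR
  obtain ⟨e, rfl⟩ : ∃ e : ι ⊕ ℕ ≃ κ ⊕ ℕ, h = e := ⟨Equiv.ofBijective h hh, rfl⟩
  -- A finite part of the bijection involving every genuine term of either side. It has at most
  -- `card ι + card κ` elements; pairs `(z, z)` make up the difference.
  set X : Finset (ι ⊕ ℕ) :=
    Finset.univ.image Sum.inl ∪ Finset.univ.image fun j => e.symm (Sum.inl j)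
    with hXdef
  have hX : ∀ i, Sum.inl i ∈ X := fun i => by simp [hXdef]
  have hY : ∀ j, Sum.inl j ∈ X.map e.toEmbedding := fun j => by simp [hXdef]
  have hcard : X.card ≤ Fintype.card ι + Fintype.card κ :=
    (Finset.card_union_le _ _).trans (add_le_add Finset.card_image_le Finset.card_image_le)
  have hι : Fintype.card ι ≤ X.card := by
    rw [← X.card_toLeft_add_card_toRight,
      show X.toLeft = Finset.univ from
        Finset.eq_univ_iff_forall.2 fun i => Finset.mem_toLeft.2 (hX i),
      Finset.card_univ]
    exact Nat.le_add_right _ _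
  have hκ : Fintype.card κ ≤ X.card := by
    rw [← X.card_map e.toEmbedding, ← (X.map e.toEmbedding).card_toLeft_add_card_toRight,
      show (X.map e.toEmbedding).toLeft = Finset.univ from
        Finset.eq_univ_iff_forall.2 fun i => Finset.mem_toLeft.2 (hY i), Finset.card_univ]
    exact Nat.le_add_right _ _
  have h₁ := map_elim_val b z X hX
  have h₂ := map_elim_val b' z (X.map e.toEmbedding) hY
  have hrel : Multiset.Rel R (X.val.map (Sum.elim b fun _ => z))
      ((X.map e.toEmbedding).val.map (Sum.elim b' fun _ => z)) := by
    rw [Finset.map_val, Multiset.map_map, Multiset.rel_map]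
    exact Multiset.rel_refl_of_refl_on fun x _ => hR x
  rw [h₁, h₂, Finset.card_map] at hrel
  have hpad := hrel.add (Multiset.rel_refl_of_refl_on (r := R)
    (m := Multiset.replicate (Fintype.card ι + Fintype.card κ - X.card) z)
    fun x hx => (Multiset.eq_of_mem_replicate hx).symm ▸ hz)
  rw [add_assoc, add_assoc, ← Multiset.replicate_add, ← Multiset.replicate_add] at hpad
  convert hpad using 3 <;> omega

/-- Related multisets are related along a bijection of their elements. -/
theorem exists_equiv_of_rel {α : Type*} [DecidableEq α] {R : α → α → Prop} {s t : Multiset α}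
    (h : Multiset.Rel R s t) : ∃ e : s.ToType ≃ t.ToType, ∀ i, R i.1 (e i).1 := by
  induction h with
  | zero => exact ⟨Equiv.refl _, fun i => isEmptyElim i⟩
  | @cons a b s t hab _ ih =>
    obtain ⟨e, he⟩ := ih
    refine ⟨Multiset.consEquiv.trans ((Equiv.optionCongr e).trans Multiset.consEquiv.symm), ?_⟩
    intro i
    obtain ⟨o, rfl⟩ := Multiset.consEquiv.symm.surjective i
    rw [Equiv.trans_apply, Equiv.trans_apply, Equiv.apply_symm_apply]
    cases o with
    | none => simpa using hab
    | some x => simpa using he x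

end Matching

/-! ### Comparison of the ends of intervals. -/

section Intervals

/-- Both ends of `J` lie at most `ε` above the corresponding ends of `I`. -/
def Dominates (ε : ℝ) (I J : RealInterval) : Prop :=
  (∀ a ∈ I.carrier, ∃ b ∈ J.carrier, b ≤ a + ε) ∧ (∀ b ∈ J.carrier, ∃ a ∈ I.carrier, b ≤ a + ε)

theorem Dominates.mono {ε δ : ℝ} {I J : RealInterval} (h : Dominates ε I J) (hεδ : ε ≤ δ) :
    Dominates δ I J :=
  ⟨fun a ha => (h.1 a ha).imp fun _ hb => ⟨hb.1, hb.2.trans (by linarith)⟩,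
    fun b hb => (h.2 b hb).imp fun _ ha => ⟨ha.1, ha.2.trans (by linarith)⟩⟩

/-- An element between the two ends of a chain of dominations lies in the middle interval. -/
theorem Dominates.mem_of_le {ε : ℝ} {I J I' : RealInterval} (h : Dominates ε I J)
    (h' : Dominates ε J I') {a b c : ℝ} (ha : a ∈ I.carrier) (hc : c ∈ I'.carrier)
    (hab : a + ε ≤ b) (hbc : b + ε ≤ c) : b ∈ J.carrier := by
  obtain ⟨x, hx, hxa⟩ := h.1 a ha
  obtain ⟨y, hy, hyc⟩ := h'.2 c hc
  exact J.ordConnected.out hx hy ⟨hxa.trans hab, by linarith⟩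

theorem RealInterval.eq_of_dominates {I J : RealInterval} (h : Dominates 0 I J)
    (h' : Dominates 0 J I) : I = J := by
  ext x
  exact ⟨fun hx => h.mem_of_le h' hx hx (by simp) (by simp),
    fun hx => h'.mem_of_le h hx hx (by simp) (by simp)⟩

/-- The lower end of an interval, with `-N` in place of `-∞`. -/
noncomputable def lowerEnd (N : ℝ) (I : RealInterval) : ℝ :=
  open Classical in if BddBelow I.carrier then sInf I.carrier else -N

/-- The upper end of an interval, with `N` in place of `∞`. -/
noncomputable def upperEnd (N : ℝ) (I : RealInterval) : ℝ :=
  open Classical in if BddAbove I.carrier then sSup I.carrier else N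

/-- The finite ends of `I` are in absolute value smaller than `N` by more than `2ε`. -/
def EndsWithin (N ε : ℝ) (I : RealInterval) : Prop :=
  |sInf I.carrier| + 2 * ε < N ∧ |sSup I.carrier| + 2 * ε < N

theorem eventually_endsWithin (ε : ℝ) (I : RealInterval) :
    ∀ᶠ N in Filter.atTop, EndsWithin N ε I :=
  (Filter.eventually_gt_atTop _).and (Filter.eventually_gt_atTop _)

variable {N ε : ℝ} {I J : RealInterval}

theorem Dominates.lowerEnd_le (hε : 0 ≤ ε) (h : Dominates ε I J) (hI : I.carrier.Nonempty)
    (hIN : EndsWithin N ε I) : lowerEnd N J ≤ lowerEnd N I + ε := by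
  unfold lowerEnd
  by_cases hJb : BddBelow J.carrier
  · have hIb : BddBelow I.carrier := by
      obtain ⟨m, hm⟩ := hJb
      refine ⟨m - ε, fun a ha => ?_⟩
      obtain ⟨b, hb, hba⟩ := h.1 a ha
      linarith [hm hb]
    rw [if_pos hJb, if_pos hIb, ← sub_le_iff_le_add]
    refine le_csInf hI fun a ha => ?_
    obtain ⟨b, hb, hba⟩ := h.1 a ha
    linarith [csInf_le hJb hb]
  · rw [if_neg hJb]
    split_ifs
    · linarith [hIN.1, neg_abs_le (sInf I.carrier)]
    · linarith

theorem Dominates.upperEnd_le (hε : 0 ≤ ε) (h : Dominates ε I J) (hJ : J.carrier.Nonempty)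
    (hJN : EndsWithin N ε J) : upperEnd N J ≤ upperEnd N I + ε := by
  unfold upperEnd
  by_cases hIb : BddAbove I.carrier
  · have hJb : BddAbove J.carrier := by
      obtain ⟨m, hm⟩ := hIb
      refine ⟨m + ε, fun b hb => ?_⟩
      obtain ⟨a, ha, hba⟩ := h.2 b hb
      linarith [hm ha]
    rw [if_pos hJb, if_pos hIb]
    refine csSup_le hJ fun b hb => ?_
    obtain ⟨a, ha, hba⟩ := h.2 b hb
    linarith [le_csSup hIb ha]
  · rw [if_neg hIb]
    split_ifs
    · linarith [hJN.2, le_abs_self (sSup J.carrier)]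
    · linarith

/-- The numerical ends forget whether endpoints belong to the interval, which costs the strict
increase from `ε` to `δ`. The bound on `N` rules out comparing an infinite end with a finite one in
the wrong direction. -/
theorem dominates_of_ends_le {δ : ℝ} (hε : 0 ≤ ε) (hεδ : ε < δ) (hI : I.carrier.Nonempty)
    (hJ : J.carrier.Nonempty) (hIN : EndsWithin N ε I) (hJN : EndsWithin N ε J)
    (hl : lowerEnd N J ≤ lowerEnd N I + ε) (hu : upperEnd N J ≤ upperEnd N I + ε) :
    Dominates δ I J := by
  unfold lowerEnd at hl
  unfold upperEnd at hu
  constructor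
  · intro a ha
    by_cases hJb : BddBelow J.carrier
    · by_cases hIb : BddBelow I.carrier
      · rw [if_pos hJb, if_pos hIb] at hl
        obtain ⟨b, hb, hlt⟩ := exists_lt_of_csInf_lt hJ
          (show sInf J.carrier < a + δ by linarith [csInf_le hIb ha])
        exact ⟨b, hb, hlt.le⟩
      · rw [if_pos hJb, if_neg hIb] at hl
        linarith [hJN.1, neg_abs_le (sInf J.carrier)]
    · obtain ⟨b, hb, hlt⟩ := not_bddBelow_iff.1 hJb (a + δ)
      exact ⟨b, hb, hlt.le⟩
  · intro b hb
    by_cases hIb : BddAbove I.carrier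
    · by_cases hJb : BddAbove J.carrier
      · rw [if_pos hJb, if_pos hIb] at hu
        obtain ⟨a, ha, hlt⟩ := exists_lt_of_lt_csSup hI
          (show b - δ < sSup I.carrier by linarith [le_csSup hJb hb])
        exact ⟨a, ha, by linarith⟩
      · rw [if_neg hJb, if_pos hIb] at hu
        linarith [hIN.2, le_abs_self (sSup I.carrier)]
    · obtain ⟨a, ha, hlt⟩ := not_bddAbove_iff.1 hIb (b - δ)
      exact ⟨a, ha, by linarith⟩

theorem lowerEnd_add_lt_upperEnd (hε : 0 ≤ ε) (hIN : EndsWithin N ε I) {a c : ℝ}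
    (ha : a ∈ I.carrier) (hc : c ∈ I.carrier) (hac : a + 2 * ε < c) :
    lowerEnd N I + 2 * ε < upperEnd N I := by
  unfold lowerEnd upperEnd
  have h₁ := hIN.1
  have h₂ := hIN.2
  have h₃ := abs_nonneg (sInf I.carrier)
  split_ifs with hb hb'
  · linarith [csInf_le hb ha, le_csSup hb' hc]
  · linarith [le_abs_self (sInf I.carrier)]
  · linarith [neg_abs_le (sSup I.carrier)]
  · linarith

theorem upperEnd_le_lowerEnd_add (hI : I.carrier.Nonempty) (hJ : J.carrier.Nonempty)
    (h : ∀ a ∈ I.carrier, ∀ c ∈ J.carrier, c < a + 2 * ε) :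
    upperEnd N J ≤ lowerEnd N I + 2 * ε := by
  obtain ⟨a₀, ha₀⟩ := hI
  obtain ⟨c₀, hc₀⟩ := hJ
  have hIb : BddBelow I.carrier := ⟨c₀ - 2 * ε, fun a ha => by linarith [h a ha c₀ hc₀]⟩
  have hJb : BddAbove J.carrier := ⟨a₀ + 2 * ε, fun c hc => (h a₀ ha₀ c hc).le⟩
  rw [upperEnd, lowerEnd, if_pos hIb, if_pos hJb]
  refine csSup_le ⟨c₀, hc₀⟩ fun c hc => ?_
  rw [← sub_le_iff_le_add]
  exact le_csInf ⟨a₀, ha₀⟩ fun a ha => by linarith [h a ha c hc]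

end Intervals

/-! ### Morphisms between interval diagrams are scalars. -/

section IntervalMorphisms

variable (K : Type u) [Field K]

open Classical in
/-- The generator of the fiber at `a` of the interval diagram of `I`. -/
noncomputable def fiberUnit (I : RealInterval) (a : ℝ) : intervalFiber K I a :=
  ⟨if a ∈ I.carrier then 1 else 0, fun h => if_neg h⟩

variable {K}

theorem fiber_eq_smul {I : RealInterval} {a : ℝ} (x : intervalFiber K I a) :
    x = (x : K) • fiberUnit K I a := by
  ext
  by_cases h : a ∈ I.carrier
  · simp [fiberUnit, h]
  · simp [fiberUnit, h, x.2 h]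

theorem intervalMap_fiberUnit {I : RealInterval} {a b : ℝ} (ha : a ∈ I.carrier)
    (hb : b ∈ I.carrier) : intervalMap K I a b (fiberUnit K I a) = fiberUnit K I b := by
  ext
  simp [intervalMap, fiberUnit, ha, hb]

theorem intervalMap_of_notMem_left {I : RealInterval} {a b : ℝ} (ha : a ∉ I.carrier) :
    intervalMap K I a b = 0 := by
  ext x
  simp [intervalMap, ha]

theorem intervalMap_of_notMem_right {I : RealInterval} {a b : ℝ} (hb : b ∉ I.carrier) :
    intervalMap K I a b = 0 := by
  ext x
  simp [intervalMap, hb]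

theorem intervalMap_coe {I : RealInterval} {a b : ℝ} (ha : a ∈ I.carrier)
    (hb : b ∈ I.carrier) (x : intervalFiber K I a) : (intervalMap K I a b x : K) = x := by
  simp [intervalMap, ha, hb]

/-- The linear maps underlying a morphism of degree `ε` between interval diagrams. -/
noncomputable def DegreeHom.lin {ε : ℝ≥0} {I J : RealInterval}
    (φ : DegreeHom ε (intervalDiagram K I) (intervalDiagram K J)) {a b : ℝ}
    (h : a + (ε : ℝ) ≤ b) : intervalFiber K I a →ₗ[K] intervalFiber K J b :=
  (φ.app h).hom.hom

/-- The matrix entry of a morphism of degree `ε` between interval diagrams. -/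
noncomputable def DegreeHom.coeff {ε : ℝ≥0} {I J : RealInterval}
    (φ : DegreeHom ε (intervalDiagram K I) (intervalDiagram K J)) {a b : ℝ}
    (h : a + (ε : ℝ) ≤ b) : K :=
  φ.lin h (fiberUnit K I a)

variable {ε : ℝ≥0} {I J : RealInterval}
  (φ : DegreeHom ε (intervalDiagram K I) (intervalDiagram K J))

theorem DegreeHom.lin_comp_intervalMap {a b c : ℝ} (h : a ≤ b) (h' : b + (ε : ℝ) ≤ c)
    (x : intervalFiber K I a) :
    φ.lin h' (intervalMap K I a b x) = φ.lin ((add_le_add_left h _).trans h') x :=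
  LinearMap.congr_fun (congrArg (fun f => f.hom.hom) (φ.map_app h h')) x

theorem DegreeHom.intervalMap_comp_lin {a b c : ℝ} (h : a + (ε : ℝ) ≤ b) (h' : b ≤ c)
    (x : intervalFiber K I a) :
    intervalMap K J b c (φ.lin h x) = φ.lin (h.trans h') x :=
  LinearMap.congr_fun (congrArg (fun f => f.hom.hom) (φ.app_map h h')) x

theorem DegreeHom.lin_coe {a b : ℝ} (h : a + (ε : ℝ) ≤ b) (x : intervalFiber K I a) :
    (φ.lin h x : K) = x * φ.coeff h := by
  conv_lhs => rw [fiber_eq_smul x]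
  simp [coeff]

theorem DegreeHom.coeff_eq_left {a a' b : ℝ} (haa' : a ≤ a') (h : a + (ε : ℝ) ≤ b)
    (h' : a' + (ε : ℝ) ≤ b) (ha : a ∈ I.carrier) (ha' : a' ∈ I.carrier) :
    φ.coeff h' = φ.coeff h := by
  rw [coeff, coeff, ← φ.lin_comp_intervalMap haa' h', intervalMap_fiberUnit ha ha']

theorem DegreeHom.coeff_eq_right {a b b' : ℝ} (hbb' : b ≤ b') (h : a + (ε : ℝ) ≤ b)
    (h' : a + (ε : ℝ) ≤ b') (hb : b ∈ J.carrier) (hb' : b' ∈ J.carrier) :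
    φ.coeff h' = φ.coeff h := by
  rw [coeff, coeff, ← φ.intervalMap_comp_lin h hbb', intervalMap_coe hb hb']

theorem DegreeHom.mem_left_of_coeff_ne_zero {a a' b : ℝ} (haa' : a ≤ a')
    (h' : a' + (ε : ℝ) ≤ b) (hne : φ.coeff ((add_le_add_left haa' _).trans h') ≠ 0) :
    a' ∈ I.carrier := by
  by_contra hmem
  refine hne ?_
  rw [coeff, ← φ.lin_comp_intervalMap haa' h', intervalMap_of_notMem_right hmem]
  simp

theorem DegreeHom.mem_right_of_coeff_ne_zero {a b b' : ℝ} (h : a + (ε : ℝ) ≤ b) (hbb' : b ≤ b')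
    (hne : φ.coeff (h.trans hbb') ≠ 0) : b ∈ J.carrier := by
  by_contra hmem
  refine hne ?_
  rw [coeff, ← φ.intervalMap_comp_lin h hbb', intervalMap_of_notMem_left hmem]
  simp

/-- Naturality compares both entries with the one from the smaller source to the target `b'`. -/
theorem DegreeHom.coeff_eq_coeff {a b a' b' : ℝ} (h : a + (ε : ℝ) ≤ b) (h' : a' + (ε : ℝ) ≤ b')
    (ha : a ∈ I.carrier) (hb : b ∈ J.carrier) (ha' : a' ∈ I.carrier) (hb' : b' ∈ J.carrier) :
    φ.coeff h = φ.coeff h' := by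
  wlog haa' : a ≤ a' generalizing a b a' b'
  · exact (this h' h ha' hb' ha hb (le_of_not_ge haa')).symm
  have h'' : a + (ε : ℝ) ≤ b' := (add_le_add_left haa' _).trans h'
  rw [φ.coeff_eq_left haa' h'' h' ha ha']
  rcases le_total b b' with hbb' | hbb'
  · exact (φ.coeff_eq_right hbb' h h'' hb hb').symm
  · exact φ.coeff_eq_right hbb' h'' h hb' hb

/-- A morphism of degree `ε` between interval diagrams is given by a single scalar, which vanishes
unless the ends of the target are at most `ε` above those of the source. -/
theorem DegreeHom.exists_scalar : ∃ c : K,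
    (∀ {a b : ℝ} (h : a + (ε : ℝ) ≤ b), a ∈ I.carrier → b ∈ J.carrier → φ.coeff h = c) ∧
      (c ≠ 0 → Dominates ε I J) := by
  by_cases hex : ∃ (a b : ℝ) (_ : a + (ε : ℝ) ≤ b), a ∈ I.carrier ∧ b ∈ J.carrier
  · obtain ⟨x, y, hxy, hx, hy⟩ := hex
    refine ⟨φ.coeff hxy, fun h ha hb => φ.coeff_eq_coeff h hxy ha hb hx hy, fun hne =>
      ⟨fun a ha => ?_, fun b hb => ?_⟩⟩
    -- Replacing `a` by `min a x` keeps `y` reachable. The nonzero map from there to `y` factors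
    -- through the fiber of `J` at `min a x + ε`, which is therefore nonzero. The upper ends are
    -- dual, with `max b y - ε`.
    · have hm : min a x ∈ I.carrier := by rcases min_choice a x with h | h <;> rwa [h]
      have hmy : min a x + (ε : ℝ) ≤ y := (add_le_add_left (min_le_right a x) _).trans hxy
      refine ⟨min a x + ε, ?_, add_le_add_left (min_le_left a x) _⟩
      refine φ.mem_right_of_coeff_ne_zero le_rfl hmy ?_
      rwa [φ.coeff_eq_coeff hmy hxy hm hy hx hy]
    · have hm : max b y ∈ J.carrier := by rcases max_choice b y with h | h <;> rwa [h]
      have hxm : x + (ε : ℝ) ≤ max b y := hxy.trans (le_max_right b y)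
      refine ⟨max b y - ε, ?_, by linarith [le_max_left b y]⟩
      refine φ.mem_left_of_coeff_ne_zero (b := max b y) (by linarith : x ≤ max b y - ε)
        (by linarith) ?_
      rwa [φ.coeff_eq_coeff hxm hxy hx hm hx hy]
  · push Not at hex
    exact ⟨0, fun h ha hb => absurd hb (hex _ _ h ha), fun h => absurd rfl h⟩

end IntervalMorphisms

/-! ### Interleavings of two interval diagrams. -/

section IntervalInterleavings

variable (K : Type u) [Field K]

open Classical in
/-- The map between fibers of interval diagrams that is the identity of `K` wherever possible. -/
noncomputable def fiberMap (I J : RealInterval) (a b : ℝ) :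
    intervalFiber K I a →ₗ[K] intervalFiber K J b where
  toFun x := ⟨if a ∈ I.carrier ∧ b ∈ J.carrier then (x : K) else 0,
    fun hb => if_neg fun h => hb h.2⟩
  map_add' x y := by
    ext
    by_cases h : a ∈ I.carrier ∧ b ∈ J.carrier <;> simp [h]
  map_smul' c x := by
    ext
    by_cases h : a ∈ I.carrier ∧ b ∈ J.carrier <;> simp [h]

theorem fiberMap_comp {I J L : RealInterval} {a b c : ℝ}
    (h : a ∈ I.carrier → c ∈ L.carrier → b ∈ J.carrier) :
    (fiberMap K J L b c).comp (fiberMap K I J a b) = fiberMap K I L a c := by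
  ext x
  by_cases ha : a ∈ I.carrier
  · by_cases hc : c ∈ L.carrier
    · simp [fiberMap, ha, h ha hc, hc]
    · simp [fiberMap, hc]
  · simp [fiberMap, ha]

variable {ε : ℝ≥0} {I J : RealInterval}

/-- The canonical morphism of degree `ε` between interval diagrams. -/
noncomputable def Dominates.degreeHom (H : Dominates ε I J) :
    DegreeHom ε (intervalDiagram K I) (intervalDiagram K J) where
  app {a b} _ := FGModuleCat.ofHom (fiberMap K I J a b)
  map_app {a b c} h h' := FGModuleCat.hom_ext <| fiberMap_comp K fun ha hc => by
    obtain ⟨x, hx, hcx⟩ := H.2 c hc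
    exact I.ordConnected.out ha hx ⟨h, by linarith⟩
  app_map {a b c} h h' := FGModuleCat.hom_ext <| fiberMap_comp K fun ha hc => by
    obtain ⟨y, hy, hya⟩ := H.1 a ha
    exact J.ordConnected.out hy hc ⟨hya.trans h, h'⟩

theorem interleaved_of_dominates (h : Dominates ε I J) (h' : Dominates ε J I) :
    Interleaved ε (intervalDiagram K I) (intervalDiagram K J) :=
  interleaved_iff.2 ⟨h.degreeHom K, h'.degreeHom K,
    fun hab hbc => FGModuleCat.hom_ext <| fiberMap_comp K fun ha hc => h.mem_of_le h' ha hc hab hbc,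
    fun hab hbc => FGModuleCat.hom_ext <| fiberMap_comp K fun ha hc => h'.mem_of_le h ha hc hab hbc⟩

theorem intervalDiagram_map_eq_zero {a c : ℝ} (hac : a ≤ c)
    (h : ¬ (a ∈ I.carrier ∧ c ∈ I.carrier)) : (intervalDiagram K I).map (homOfLE hac) = 0 := by
  refine FGModuleCat.hom_ext (show intervalMap K I a c = 0 from ?_)
  by_cases ha : a ∈ I.carrier
  · exact intervalMap_of_notMem_right fun hc => h ⟨ha, hc⟩
  · exact intervalMap_of_notMem_left ha

/-- Zero morphisms interleave, since all structure maps of length at least `2ε` vanish. -/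
theorem interleaved_of_short (hI : ∀ a ∈ I.carrier, ∀ c ∈ I.carrier, c < a + 2 * (ε : ℝ))
    (hJ : ∀ a ∈ J.carrier, ∀ c ∈ J.carrier, c < a + 2 * (ε : ℝ)) :
    Interleaved ε (intervalDiagram K I) (intervalDiagram K J) := by
  refine interleaved_iff.2 ⟨⟨fun _ => 0, fun _ _ => comp_zero, fun _ _ => zero_comp⟩,
    ⟨fun _ => 0, fun _ _ => comp_zero, fun _ _ => zero_comp⟩, fun {a b c} h h' => ?_,
    fun {a b c} h h' => ?_⟩
  · exact comp_zero.trans (intervalDiagram_map_eq_zero K _ fun ⟨ha, hc⟩ => by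
      linarith [hI a ha c hc]).symm
  · exact comp_zero.trans (intervalDiagram_map_eq_zero K _ fun ⟨ha, hc⟩ => by
      linarith [hJ a ha c hc]).symm

end IntervalInterleavings

/-! ### From an interleaving to a matching of long intervals. -/

section Stability

variable {K : Type u} [Field K] {ι κ : Type} [Fintype ι] [Fintype κ]
  {b : ι → RealInterval} {b' : κ → RealInterval} {ε : ℝ≥0}

/-- Interleavings of direct sums of interval diagrams, as matrices of scalars. -/
theorem Interleaved.exists_matrix [DecidableEq ι]
    (H : Interleaved ε (⨁ fun i => intervalDiagram K (b i)) (⨁ fun j => intervalDiagram K (b' j))) :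
    ∃ (C : ι → κ → K) (D : κ → ι → K),
      (∀ i j, C i j ≠ 0 → Dominates ε (b i) (b' j)) ∧
      (∀ j i, D j i ≠ 0 → Dominates ε (b' j) (b i)) ∧
      ∀ i i', ∀ a ∈ (b i).carrier, ∀ c ∈ (b i').carrier, a + 2 * (ε : ℝ) ≤ c →
        ∑ j, C i j * D j i' = if i = i' then 1 else 0 := by
  obtain ⟨φ, ψ, h₁, -⟩ := interleaved_iff.1 H
  choose C hC hC' using fun i j => (φ.component i j).exists_scalar
  choose D hD hD' using fun j i => (ψ.component j i).exists_scalar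
  refine ⟨C, D, hC', hD', fun i i' a ha c hc hac => ?_⟩
  have hbc : a + (ε : ℝ) + ε ≤ c := by linarith
  have key : ∀ j, (((ψ.component j i').lin hbc ((φ.component i j).lin le_rfl
      (fiberUnit K (b i) a)) : intervalFiber K (b i') c) : K) = C i j * D j i' := by
    intro j
    rw [DegreeHom.lin_coe]
    by_cases hj : a + (ε : ℝ) ∈ (b' j).carrier
    · exact congrArg₂ _ (hC i j le_rfl ha hj) (hD j i' hbc hj hc)
    -- If `a + ε` misses the middle interval the composite is zero; so is the product of scalars,
    -- since two nonzero scalars would force `a + ε` into that interval.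
    · rw [show ((φ.component i j).lin le_rfl (fiberUnit K (b i) a) : K) = 0 from
        ((φ.component i j).lin le_rfl (fiberUnit K (b i) a)).2 hj, zero_mul]
      by_contra hne
      exact hj ((hC' i j (left_ne_zero_of_mul (Ne.symm hne))).mem_of_le
        (hD' j i' (right_ne_zero_of_mul (Ne.symm hne))) ha hc le_rfl hbc)
  let ev : ((intervalDiagram K (b i)).obj a ⟶ (intervalDiagram K (b i')).obj c) →+ K :=
    { toFun := fun f => (intervalFiber K (b i') c).subtype (f.hom.hom (fiberUnit K (b i) a))
      map_zero' := rfl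
      map_add' := fun _ _ => rfl }
  have hsum := congrArg ev (φ.sum_component_comp ψ h₁ i i' (le_refl (a + (ε : ℝ))) hbc)
  rw [map_sum] at hsum
  refine (Finset.sum_congr rfl fun j _ => (key j).symm).trans (hsum.trans ?_)
  split_ifs with h
  · subst h
    rw [ι_π_app_self, Category.comp_id]
    refine (intervalMap_coe ha hc _).trans ?_
    simp [fiberUnit, ha]
  · rw [ι_π_app_ne _ h, comp_zero, map_zero]

/-- `I` is longer than `2ε`. -/
def IsLong (ε : ℝ) (I : RealInterval) : Prop :=
  ∃ a ∈ I.carrier, ∃ c ∈ I.carrier, a + 2 * ε < c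

/-- Ordering the long intervals by midpoint makes the matrix lemma applicable; truncating infinite
ends at a common large `N` gives every nonempty interval a midpoint. -/
theorem exists_injective_of_interleaved
    (H : Interleaved ε (⨁ fun i => intervalDiagram K (b i)) (⨁ fun j => intervalDiagram K (b' j))) :
    ∃ f : {i | IsLong ε (b i)} → κ,
      Function.Injective f ∧ ∀ (i : {i | IsLong ε (b i)}) (δ : ℝ), ε < δ →
        Dominates δ (b i) (b' (f i)) ∧ Dominates δ (b' (f i)) (b i) := by
  classical
  obtain ⟨C, D, hC, hD, hsum⟩ := H.exists_matrix
  set S := {i | IsLong ε (b i)}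
  have hε : (0 : ℝ) ≤ ε := ε.coe_nonneg
  obtain ⟨N, hN, hN'⟩ : ∃ N : ℝ, (∀ i, EndsWithin N ε (b i)) ∧ ∀ j, EndsWithin N ε (b' j) :=
    ((Filter.eventually_all.2 fun i => eventually_endsWithin (ε : ℝ) (b i)).and
      (Filter.eventually_all.2 fun j => eventually_endsWithin (ε : ℝ) (b' j))).exists
  have hne : ∀ i : S, (b i).carrier.Nonempty := fun i => ⟨_, i.2.choose_spec.1⟩
  have hlong : ∀ i : S, lowerEnd N (b i) + 2 * ε < upperEnd N (b i) := by
    rintro ⟨i, a, ha, c, hc, hac⟩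
    exact lowerEnd_add_lt_upperEnd hε (hN i) ha hc hac
  let _ : Preorder S := Preorder.lift fun i : S => lowerEnd N (b i) + upperEnd N (b i)
  have hle : ∀ i i' : S, ¬ i' < i →
      lowerEnd N (b i) + upperEnd N (b i) ≤ lowerEnd N (b i') + upperEnd N (b i') :=
    fun i i' h => not_lt.1 h
  have hends : ∀ (i i' : S) j, C i j ≠ 0 → D j i' ≠ 0 → (b' j).carrier.Nonempty ∧
      lowerEnd N (b' j) ≤ lowerEnd N (b i) + ε ∧ upperEnd N (b' j) ≤ upperEnd N (b i) + ε ∧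
      lowerEnd N (b i') ≤ lowerEnd N (b' j) + ε ∧ upperEnd N (b i') ≤ upperEnd N (b' j) + ε := by
    intro i i' j h h'
    have hJ : (b' j).carrier.Nonempty := by
      obtain ⟨a, ha⟩ := hne i
      obtain ⟨y, hy, -⟩ := (hC i j h).1 a ha
      exact ⟨y, hy⟩
    exact ⟨hJ, (hC i j h).lowerEnd_le hε (hne i) (hN i), (hC i j h).upperEnd_le hε hJ (hN' j),
      (hD j i' h').lowerEnd_le hε hJ (hN' j), (hD j i' h').upperEnd_le hε (hne i') (hN i')⟩
  refine exists_injective_of_matrix (fun (i : S) j => C i j) (fun j (i : S) => D j i)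
    (fun i j => ∀ δ : ℝ, ε < δ → Dominates δ (b i) (b' j) ∧ Dominates δ (b' j) (b i)) ?_ ?_
  · intro i i' hlt
    by_cases hex : ∃ a ∈ (b i).carrier, ∃ c ∈ (b i').carrier, a + 2 * (ε : ℝ) ≤ c
    · obtain ⟨a, ha, c, hc, hac⟩ := hex
      simpa only [Subtype.ext_iff] using hsum i i' a ha c hc hac
    -- Here the upper end of `b i'` is at most `2ε` above the lower end of `b i`. As both intervals
    -- are longer than `2ε`, both ends of `b i'` lie below those of `b i`, contradicting the order
    -- of midpoints.
    · push Not at hex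
      have hii' : i ≠ i' := by
        rintro rfl
        obtain ⟨a, ha, c, hc, hac⟩ := i.2
        exact (hex a ha c hc).not_gt hac
      rw [if_neg hii']
      refine Finset.sum_eq_zero fun j _ => ?_
      by_contra hprod
      obtain ⟨-, h₁, h₂, h₃, h₄⟩ := hends i i' j (left_ne_zero_of_mul hprod)
        (right_ne_zero_of_mul hprod)
      have := upperEnd_le_lowerEnd_add (N := N) (hne i) (hne i') hex
      linarith [hle i i' hlt, hlong i, hlong i']
  · intro i i' j hlt h h'
    obtain ⟨hJ, h₁, h₂, h₃, h₄⟩ := hends i i' j h h'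
    have hs := hle i i' hlt
    -- Going from `b i` through `b' j` to `b i'`, each end rises by at most `ε` per step. If one end
    -- drops by more than `ε` in the first step, then, as the midpoint does not drop overall,
    -- neither end drops by more than `ε` in the second.
    by_cases hcase : lowerEnd N (b i) ≤ lowerEnd N (b' j) + ε ∧
        upperEnd N (b i) ≤ upperEnd N (b' j) + ε
    · exact Or.inl fun δ hδ => ⟨(hC i j h).mono hδ.le,
        dominates_of_ends_le hε hδ hJ (hne i) (hN' j) (hN i) hcase.1 hcase.2⟩
    · refine Or.inr fun δ hδ => ⟨dominates_of_ends_le hε hδ (hne i') hJ (hN i') (hN' j) ?_ ?_,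
        (hD j i' h').mono hδ.le⟩
      all_goals
        by_contra hcon
        refine hcase ⟨?_, ?_⟩ <;> linarith

end Stability

/-! ### The isometry theorem and uniqueness of barcodes. -/

section Isometry

variable {K : Type u} [Field K]

theorem isZero_intervalDiagram_empty : IsZero (intervalDiagram K RealInterval.empty) := by
  refine (IsZero.iff_id_eq_zero _).2 ?_
  ext a : 2
  refine FGModuleCat.hom_ext (LinearMap.ext fun x => Subtype.ext ?_)
  exact (x : intervalFiber K RealInterval.empty a).2 (Set.notMem_empty a)

/-- Adding an empty interval to a barcode does not change its diagram. -/
noncomputable def barcodeDiagramConsEmptyIso (B : FiniteBarcode) :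
    barcodeDiagram K (RealInterval.empty ::ₘ B) ≅ barcodeDiagram K B :=
  (biproductIsoOfInjective
    (fun I : (RealInterval.empty ::ₘ B).ToType => intervalDiagram K I.1)
    (j := fun I : B.ToType => Multiset.consEquiv.symm (some I))
    (fun _ _ h => Option.some_injective _ (Multiset.consEquiv.symm.injective h))
    (fun I hI => by
      obtain ⟨o, rfl⟩ := Multiset.consEquiv.symm.surjective I
      cases o with
      | none => simpa using isZero_intervalDiagram_empty
      | some x => exact absurd ⟨x, rfl⟩ hI)).symm ≪≫ eqToIso (by simp [barcodeDiagram])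

theorem nonempty_barcodeDiagram_add_replicate_iso (B : FiniteBarcode) (n : ℕ) :
    Nonempty (barcodeDiagram K (B + Multiset.replicate n RealInterval.empty) ≅
      barcodeDiagram K B) := by
  induction n with
  | zero => exact ⟨eqToIso (by simp)⟩
  | succ n ih =>
    obtain ⟨e⟩ := ih
    rw [Multiset.replicate_succ, Multiset.add_cons]
    exact ⟨barcodeDiagramConsEmptyIso _ ≪≫ e⟩

theorem interleavingDist_barcodeDiagram_le (B B' : FiniteBarcode) :
    interleavingDist (barcodeDiagram K B) (barcodeDiagram K B') ≤ bottleneckDist K B B' := by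
  obtain ⟨e⟩ := nonempty_barcodeDiagram_add_replicate_iso (K := K) B (Multiset.card B')
  obtain ⟨e'⟩ := nonempty_barcodeDiagram_add_replicate_iso (K := K) B' (Multiset.card B)
  rw [← interleavingDist_eq_of_iso e e']
  exact le_iInf fun f => interleavingDist_biproduct_le f

theorem bottleneckDist_le (B B' : FiniteBarcode) :
    bottleneckDist K B B' ≤ interleavingDist (barcodeDiagram K B) (barcodeDiagram K B') := by
  refine le_iInf₂ fun ε H => ?_
  obtain ⟨f, hf, hfR⟩ := exists_injective_of_interleaved H
  obtain ⟨g, hg, hgR⟩ := exists_injective_of_interleaved H.symm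
  have hshort : ∀ (L : RealInterval) (δ : ℝ≥0), ε < δ →
      ¬ IsLong ε L →
      ∀ a ∈ L.carrier, ∀ c ∈ L.carrier, c < a + 2 * (δ : ℝ) := by
    intro L δ hδ hL a ha c hc
    unfold IsLong at hL
    push Not at hL
    have hδ' : (ε : ℝ) < δ := hδ
    linarith [hL a ha c hc]
  have hrel := exists_rel_of_injOn
    (fun I J => interleavingDist (intervalDiagram K I) (intervalDiagram K J) ≤ ε)
    RealInterval.empty
    ((isExtendedPseudometric_interleavingDist.self _).trans_le bot_le)
    (fun I : B.ToType => I.1) (fun J : B'.ToType => J.1) _ _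
    (fun i hi => interleavingDist_le_of_forall_lt fun δ hδ =>
      interleaved_of_short K (hshort _ δ hδ hi) fun a ha => absurd ha (Set.notMem_empty a))
    (fun j hj => interleavingDist_le_of_forall_lt fun δ hδ =>
      interleaved_of_short K (fun a ha => absurd ha (Set.notMem_empty a)) (hshort _ δ hδ hj))
    f hf (fun i => interleavingDist_le_of_forall_lt fun δ hδ =>
      interleaved_of_dominates K (hfR i δ hδ).1 (hfR i δ hδ).2)
    g hg (fun j => interleavingDist_le_of_forall_lt fun δ hδ =>
      interleaved_of_dominates K (hgR j δ hδ).2 (hgR j δ hδ).1)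
  rw [Multiset.map_univ_coe, Multiset.map_univ_coe, Multiset.card_coe, Multiset.card_coe] at hrel
  obtain ⟨e, he⟩ := exists_equiv_of_rel hrel
  exact iInf_le_of_le e (iSup_le he)

theorem interleavingDist_barcodeDiagram (B B' : FiniteBarcode) :
    interleavingDist (barcodeDiagram K B) (barcodeDiagram K B') = bottleneckDist K B B' :=
  le_antisymm (interleavingDist_barcodeDiagram_le B B') (bottleneckDist_le B B')

/-- An isomorphism is a `0`-interleaving, and `0`-domination both ways is equality, so the matrix
lemma with equality as its relation injects `B` into `B'`. Applied both ways this gives uniqueness.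
-/
theorem le_of_barcodeDiagram_iso {B B' : FiniteBarcode} (hB : RealInterval.empty ∉ B)
    (e : barcodeDiagram K B ≅ barcodeDiagram K B') : B ≤ B' := by
  classical
  obtain ⟨C, D, hC, hD, hsum⟩ := (Interleaved.of_iso e).exists_matrix
  simp only [NNReal.coe_zero, mul_zero, add_zero] at hC hD hsum
  have hne : ∀ i : B.ToType, i.1.carrier.Nonempty := fun i => by
    by_contra h
    have : i.1 = RealInterval.empty := RealInterval.ext (Set.not_nonempty_iff_eq_empty.1 h)
    exact hB (this ▸ Multiset.coe_mem)
  have htrans : ∀ {I J L : RealInterval}, Dominates 0 I J → Dominates 0 J L → Dominates 0 I L := by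
    intro I J L h h'
    refine ⟨fun a ha => ?_, fun c hc => ?_⟩
    · obtain ⟨y, hy, hya⟩ := h.1 a ha
      obtain ⟨z, hz, hzy⟩ := h'.1 y hy
      exact ⟨z, hz, by linarith⟩
    · obtain ⟨y, hy, hcy⟩ := h'.2 c hc
      obtain ⟨x, hx, hyx⟩ := h.2 y hy
      exact ⟨x, hx, by linarith⟩
  -- The order is reversed domination: nonzero `C i j` and `D j i'` give `i' ≤ i`, so when `i' < i`
  -- fails, all three intervals coincide.
  let _ : Preorder B.ToType :=
    { le := fun i i' => Dominates 0 i'.1 i.1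
      le_refl := fun i => ⟨fun a ha => ⟨a, ha, by simp⟩, fun a ha => ⟨a, ha, by simp⟩⟩
      le_trans := fun i j k h h' => htrans h' h }
  have heq : ∀ (i i' : B.ToType) (j : B'.ToType), ¬ i' < i → C i j ≠ 0 → D j i' ≠ 0 →
      i.1 = j.1 ∧ i'.1 = j.1 := by
    intro i i' j hlt h h'
    have h₁ : Dominates 0 i.1 i'.1 := htrans (hC i j h) (hD j i' h')
    have h₂ : Dominates 0 i'.1 i.1 := by
      by_contra hcon
      exact hlt ⟨h₁, hcon⟩
    exact ⟨RealInterval.eq_of_dominates (hC i j h) (htrans (hD j i' h') h₂),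
      RealInterval.eq_of_dominates (htrans h₂ (hC i j h)) (hD j i' h')⟩
  have hunit : ∀ i i', ¬ i' < i → ∑ j, C i j * D j i' = if i = i' then 1 else 0 := by
    intro i i' hlt
    by_cases hzero : ∀ j, C i j * D j i' = 0
    · rw [Finset.sum_eq_zero fun j _ => hzero j, if_neg]
      rintro rfl
      obtain ⟨a, ha⟩ := hne i
      have := hsum i i a ha a ha le_rfl
      rw [Finset.sum_eq_zero fun j _ => hzero j, if_pos rfl] at this
      exact zero_ne_one this
    -- A nonzero term makes the intervals of `i` and `i'` equal, so the matrix identity can be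
    -- evaluated at a common point.
    · push Not at hzero
      obtain ⟨j, hj⟩ := hzero
      obtain ⟨h₁, h₂⟩ := heq i i' j hlt (left_ne_zero_of_mul hj) (right_ne_zero_of_mul hj)
      obtain ⟨a, ha⟩ := hne i
      exact hsum i i' a ha a (by rwa [h₂, ← h₁]) le_rfl
  obtain ⟨f, hf, hfeq⟩ := exists_injective_of_matrix C D (fun i j => i.1 = j.1) hunit
    fun i i' j hlt h h' => Or.inl (heq i i' j hlt h h').1
  calc B = Finset.univ.val.map (fun i : B.ToType => i.1) := B.map_univ_coe.symm
    _ = (Finset.univ.map ⟨f, hf⟩).val.map (fun j : B'.ToType => j.1) := by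
      rw [Finset.map_val, Multiset.map_map]
      exact Multiset.map_congr rfl fun i _ => hfeq i
    _ ≤ Finset.univ.val.map (fun j : B'.ToType => j.1) :=
      Multiset.map_le_map (Finset.val_le_iff.2 (Finset.subset_univ _))
    _ = B' := B'.map_univ_coe

end Isometry

end Persistence

theorem theorem4 (K : Type*) [Field K] :
    Persistence.IsExtendedPseudometric (Persistence.bottleneckDist K) ∧
    Persistence.IsExtendedPseudometric
      (fun F G : Persistence.VecDiagram K => Persistence.interleavingDist F G) ∧
    (∀ B B' : Persistence.FiniteBarcode,
      Persistence.interleavingDist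
          (Persistence.barcodeDiagram K B) (Persistence.barcodeDiagram K B') =
        Persistence.bottleneckDist K B B') ∧
    (∀ B B' : Persistence.FiniteBarcode,
      Persistence.RealInterval.empty ∉ B → Persistence.RealInterval.empty ∉ B' →
      Nonempty (Persistence.barcodeDiagram K B ≅ Persistence.barcodeDiagram K B') →
      B = B') := by
  have hd := Persistence.isExtendedPseudometric_interleavingDist (D := FGModuleCat K)
  refine ⟨?_, hd, Persistence.interleavingDist_barcodeDiagram, fun B B' hB hB' ⟨e⟩ =>
    le_antisymm (Persistence.le_of_barcodeDiagram_iso hB e)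
      (Persistence.le_of_barcodeDiagram_iso hB' e.symm)⟩
  constructor
  · intro B
    rw [← Persistence.interleavingDist_barcodeDiagram]
    exact hd.self _
  · intro B B'
    simp only [← Persistence.interleavingDist_barcodeDiagram]
    exact hd.symm _ _
  · intro B B' B''
    simp only [← Persistence.interleavingDist_barcodeDiagram]
    exact hd.triangle _ _ _
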